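/- For integers $d\ge 1$ and $n\ge 0$ let $S_d=\{x\in\mathbb R^d : x_i\ge 0,\ \sum_i x_i\le 1\}$, with barycentric coordinates $b_0=1-\sum_i x_i$, $b_i=x_i$ ($1\le i\le d$), and for a multiindex $\alpha=(\alpha_0,\dots,\alpha_d)$ of nonnegative integers with $|\alpha|=n$ let $B^n_\alpha=\frac{n!}{\alpha!}\prod_{i=0}^d b_i^{\alpha_i}$ be the Bernstein polynomial. Let $M^{d,n}$ be the Bernstein mass matrix, $M^{d,n}_{\alpha\beta}=\int_{S_d}B^n_\alpha B^n_\beta\,dx$ for $|\alpha|=|\beta|=n$. Consider the unpreconditioned conjugate gradient method for $M^{d,n}x=y$ in exact arithmetic with initial guess $x_0$: $r_0=p_0=y-M^{d,n}x_0$ and $$a_k=\frac{r_k\cdot r_k}{p_k\cdot M^{d,n}p_k},\quad x_{k+1}=x_k+a_kp_k,\quad r_{k+1}=r_k-a_kM^{d,n}p_k,\quad p_{k+1}=r_{k+1}+\frac{r_{k+1}\cdot r_{k+1}}{r_k\cdot r_k}\,p_k .$$ Say that it solves the system in exactly $k$ iterations if $M^{d,n}x_k=y$, $M^{d,n}x_j\ne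 y$ for all $j<k$, and the denominators $p_j\cdot M^{d,n}p_j$ and $r_j\cdot r_j$ are nonzero for all $j<k$. Then, for all $d\ge1$ and $n\ge0$: 1. $M^{d,n}$ has exactly $n+1$ distinct eigenvalues. 2. For every right-hand side $y$ and every initial guess $x_0$, the method solves $M^{d,n}x=y$ in exactly $k$ iterations for some $k\le n+1$. 3. The method solves $M^{d,n}x=y$ in exactly $n+1$ iterations if and only if the initial residual $y-M^{d,n}x_0$ is orthogonal to no eigenspace of $M^{d,n}$ (i.e. it has a nonzero component in each of the eigenspaces). 4. In particular, for every initial guess $x_0$, the method solves $M^{d,n}x=y$ in exactly $n+1$ iterations for Lebesgue-almost every right-hand side $y$. The number $n+1$ does not depend on $d$. -/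

import Mathlib

open MeasureTheory

noncomputable section

/-- Multiindices `α = (α₀, …, α_d)` of order `|α| = n`. -/
abbrev MultiIndex (d n : ℕ) : Type :=
  {α : Fin (d + 1) → ℕ // α ∈ Finset.piAntidiag Finset.univ n}

/-- The unit right simplex `S_d` in `ℝ^d`, with vertices `0, e₁, …, e_d`. -/
def unitSimplex (d : ℕ) : Set (Fin d → ℝ) :=
  {x | (∀ i, 0 ≤ x i) ∧ ∑ i, x i ≤ 1}

/-- The barycentric coordinates `b₀ = 1 - ∑ xᵢ`, `bᵢ = xᵢ` (`1 ≤ i ≤ d`) on the unit right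
simplex. -/
def baryCoord (d : ℕ) (x : Fin d → ℝ) : Fin (d + 1) → ℝ :=
  Fin.cons (1 - ∑ i, x i) x

/-- The Bernstein polynomial `B^n_α = (n! / α!) b^α` on the unit right simplex. -/
def bernsteinSimplex (d n : ℕ) (α : MultiIndex d n) (x : Fin d → ℝ) : ℝ :=
  (n.factorial : ℝ) / (∏ i, ((α.1 i).factorial : ℝ)) * ∏ i, baryCoord d x i ^ α.1 i

/-- The Bernstein mass matrix `M^{d,n}`: the Gram matrix in `L²(S_d)` of the Bernstein
polynomials of degree `n`. -/
def massMatrix (d n : ℕ) : Matrix (MultiIndex d n) (MultiIndex d n) ℝ :=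
  Matrix.of fun α β =>
    ∫ x in unitSimplex d, bernsteinSimplex d n α x * bernsteinSimplex d n β x

section ConjugateGradient

variable {ι : Type*} [Fintype ι]

/-- The data carried by the conjugate gradient iteration: the iterate, the residual and the
search direction. -/
structure CGState (ι : Type*) where
  /-- the current approximate solution -/
  x : ι → ℝ
  /-- the current residual -/
  r : ι → ℝ
  /-- the current search direction -/
  p : ι → ℝ

/-- Initialization for `A x = y` with initial guess `x₀`: `r₀ = p₀ = y - A x₀`. -/
def cgInit (A : Matrix ι ι ℝ) (y x₀ : ι → ℝ) : CGState ι :=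
  ⟨x₀, y - A.mulVec x₀, y - A.mulVec x₀⟩

/-- One step of the unpreconditioned conjugate gradient method in exact arithmetic:
`a = (r·r)/(p·Ap)`, `x' = x + a p`, `r' = r - a A p`, `b = (r'·r')/(r·r)`, `p' = r' + b p`. -/
def cgStep (A : Matrix ι ι ℝ) (s : CGState ι) : CGState ι :=
  let a : ℝ := (s.r ⬝ᵥ s.r) / (s.p ⬝ᵥ A.mulVec s.p)
  let r' : ι → ℝ := s.r - a • A.mulVec s.p
  let b : ℝ := (r' ⬝ᵥ r') / (s.r ⬝ᵥ s.r)
  ⟨s.x + a • s.p, r', r' + b • s.p⟩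

/-- The state of the conjugate gradient method for `A x = y`, started at `x₀`, after `k`
iterations. -/
def cgIter (A : Matrix ι ι ℝ) (y x₀ : ι → ℝ) : ℕ → CGState ι
  | 0 => cgInit A y x₀
  | k + 1 => cgStep A (cgIter A y x₀ k)

/-- The conjugate gradient method for `A x = y`, started at `x₀`, solves the system in exactly
`k` iterations: the iterate `x_k` is an exact solution, no earlier iterate is one, and the method
does not break down on the way: each of the `k` steps divides by nonzero numbers `p·Ap`, `r·r`. -/
def CGSolvesInExactly (A : Matrix ι ι ℝ) (y x₀ : ι → ℝ) (k : ℕ) : Prop :=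
  A.mulVec (cgIter A y x₀ k).x = y ∧
    ∀ j < k, A.mulVec (cgIter A y x₀ j).x ≠ y ∧
      (cgIter A y x₀ j).p ⬝ᵥ A.mulVec (cgIter A y x₀ j).p ≠ 0 ∧
      (cgIter A y x₀ j).r ⬝ᵥ (cgIter A y x₀ j).r ≠ 0

end ConjugateGradient

end

/-! Conjugate gradients see a symmetric positive definite matrix `A` only through its eigenvalues.
The residual is `q(A) r₀` with `q(0) = 1` and `deg q ≤ k`, and nonzero residuals are mutually
orthogonal, so a polynomial of degree `m` annihilating `r₀` stops the method within `m` steps.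
Conversely, a vanishing residual forces `q(μ) = 0` at every eigenvalue `μ` whose eigenspace is not
orthogonal to `r₀` (`cgSolvesInExactly_card_iff`).

For the spectrum, `chooseVec n γ` lists, up to a constant, the Bernstein coefficients of the
monomial `b^γ`. Dirichlet's integral and Vandermonde's identity show that the mass matrix is
triangular for the filtration by `|γ|` and acts on the `k`-th graded piece as the scalar
`massEigenvalue d n k` (`massMatrix_sub_eigenvalue_mem_chooseSpan`). Hence at most these `n + 1`
numbers are eigenvalues. They are distinct and positive, and each occurs already on the span of the
vectors `α ↦ (α₀ choose k)` (`hasEigenvalue_massEigenvalue`). -/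

noncomputable section

/-! ### Finite termination of conjugate gradients. -/

section ConjugateGradientTheory

open Polynomial

variable {ι : Type*} [Fintype ι] (A : Matrix ι ι ℝ) (y x₀ : ι → ℝ)

theorem cgIter_residual_eq (k : ℕ) :
    (cgIter A y x₀ k).r = y - A.mulVec (cgIter A y x₀ k).x := by
  induction k with
  | zero => rfl
  | succ k ih =>
    simp only [cgIter, cgStep]
    rw [ih, Matrix.mulVec_add, Matrix.mulVec_smul]
    abel

theorem cgIter_residual_succ (k : ℕ) :
    (cgIter A y x₀ (k + 1)).r = (cgIter A y x₀ k).r -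
      ((cgIter A y x₀ k).r ⬝ᵥ (cgIter A y x₀ k).r /
        ((cgIter A y x₀ k).p ⬝ᵥ A.mulVec (cgIter A y x₀ k).p)) •
        A.mulVec (cgIter A y x₀ k).p := rfl

theorem cgIter_direction_succ (k : ℕ) :
    (cgIter A y x₀ (k + 1)).p = (cgIter A y x₀ (k + 1)).r +
      ((cgIter A y x₀ (k + 1)).r ⬝ᵥ (cgIter A y x₀ (k + 1)).r /
        ((cgIter A y x₀ k).r ⬝ᵥ (cgIter A y x₀ k).r)) • (cgIter A y x₀ k).p := rfl

theorem dotProduct_mulVec_comm_of_isSymm {A : Matrix ι ι ℝ} (hA : A.IsSymm) (u v : ι → ℝ) :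
    u ⬝ᵥ A.mulVec v = A.mulVec u ⬝ᵥ v := by
  rw [Matrix.dotProduct_mulVec, ← Matrix.mulVec_transpose, hA.eq]

/-- A vector orthogonal to all search directions up to step `i` is orthogonal to the residual
at step `i`. -/
theorem dotProduct_residual_eq_zero {i : ℕ} {v : ι → ℝ}
    (h : ∀ j ≤ i, v ⬝ᵥ (cgIter A y x₀ j).p = 0) : v ⬝ᵥ (cgIter A y x₀ i).r = 0 := by
  cases i with
  | zero => exact h 0 le_rfl
  | succ i =>
    have h1 := h (i + 1) le_rfl
    rw [cgIter_direction_succ, dotProduct_add, dotProduct_smul, h i (Nat.le_succ i)] at h1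
    simpa using h1

variable {A}

theorem dotProduct_mulVec_pos_of_ne_zero (hA : A.PosDef) {v : ι → ℝ} (hv : v ≠ 0) :
    0 < v ⬝ᵥ A.mulVec v := by
  simpa using hA.dotProduct_mulVec_pos hv

/-- The residual at step `k` is orthogonal to the previous search directions, and the search
direction at step `k` is conjugate to the previous ones, provided the previous residuals do not
vanish. -/
theorem cgIter_orthogonality (hA : A.PosDef) (k : ℕ)
    (hr : ∀ j < k, (cgIter A y x₀ j).r ≠ 0) :
    (∀ i < k, (cgIter A y x₀ k).r ⬝ᵥ (cgIter A y x₀ i).p = 0) ∧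
      (∀ i < k, (cgIter A y x₀ k).p ⬝ᵥ A.mulVec (cgIter A y x₀ i).p = 0) ∧
      (cgIter A y x₀ k).r ⬝ᵥ (cgIter A y x₀ k).p =
        (cgIter A y x₀ k).r ⬝ᵥ (cgIter A y x₀ k).r := by
  have hS : A.IsSymm := by simpa [Matrix.IsHermitian, Matrix.IsSymm] using hA.isHermitian
  induction k using Nat.strong_induction_on with
  | _ k ih =>
  cases k with
  | zero => exact ⟨by simp, by simp, rfl⟩
  | succ k =>
    -- `p_i = 0` would give `r_i · r_i = r_i · p_i = 0`.
    have hpos : ∀ i ≤ k, 0 < (cgIter A y x₀ i).p ⬝ᵥ A.mulVec (cgIter A y x₀ i).p := by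
      intro i hi
      refine dotProduct_mulVec_pos_of_ne_zero hA fun h0 => hr i (by omega) ?_
      have h1 := (ih i (by omega) fun j hj => hr j (by omega)).2.2
      rw [h0, dotProduct_zero] at h1
      exact dotProduct_self_eq_zero.1 h1.symm
    have hrr : ∀ i ≤ k, (cgIter A y x₀ i).r ⬝ᵥ (cgIter A y x₀ i).r ≠ 0 := fun i hi h0 =>
      hr i (by omega) (dotProduct_self_eq_zero.1 h0)
    obtain ⟨hc, hb, hrp⟩ := ih k (by omega) fun j hj => hr j (by omega)
    have hc' : ∀ i < k + 1, (cgIter A y x₀ (k + 1)).r ⬝ᵥ (cgIter A y x₀ i).p = 0 := by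
      intro i hi
      rw [cgIter_residual_succ, sub_dotProduct, smul_dotProduct,
        ← dotProduct_mulVec_comm_of_isSymm hS]
      rcases Nat.lt_succ_iff_lt_or_eq.1 hi with h | rfl
      · rw [hc i h, hb i h]; simp
      · rw [hrp, smul_eq_mul, div_mul_cancel₀ _ (hpos i le_rfl).ne', sub_self]
    have ha : ∀ i ≤ k, (cgIter A y x₀ (k + 1)).r ⬝ᵥ (cgIter A y x₀ i).r = 0 := fun i hi =>
      dotProduct_residual_eq_zero A y x₀ fun j hj => hc' j (by omega)
    refine ⟨hc', fun i hi => ?_, ?_⟩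
    -- Pairing the residual recurrence with `r_{k+1}` expresses `r_{k+1} · A p_i` through `r_{k+1} ·
    -- r_{i+1}`. This vanishes for `i < k`; for `i = k` the coefficient in `p_{k+1}` is chosen to
    -- cancel it.
    · have hstep := congrArg ((cgIter A y x₀ (k + 1)).r ⬝ᵥ ·) (cgIter_residual_succ A y x₀ i)
      simp only [dotProduct_sub, dotProduct_smul, smul_eq_mul] at hstep
      rw [ha i (by omega), zero_sub] at hstep
      rw [cgIter_direction_succ, add_dotProduct, smul_dotProduct, smul_eq_mul]
      have h1 := hpos i (by omega)
      have h2 := hrr i (by omega)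
      rcases Nat.lt_succ_iff_lt_or_eq.1 hi with h | rfl
      · rw [ha (i + 1) h, eq_comm, neg_eq_zero, mul_eq_zero] at hstep
        rw [hb i h, mul_zero, add_zero]
        exact hstep.resolve_left (div_ne_zero h2 h1.ne')
      · rw [hstep]
        field_simp
        ring
    · rw [cgIter_direction_succ, dotProduct_add, dotProduct_smul, hc' k (by omega)]
      simp

theorem cgIter_residual_orthogonal (hA : A.PosDef) {k i : ℕ} (hik : i < k)
    (hr : ∀ j < k, (cgIter A y x₀ j).r ≠ 0) :
    (cgIter A y x₀ k).r ⬝ᵥ (cgIter A y x₀ i).r = 0 :=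
  dotProduct_residual_eq_zero A y x₀ fun j hj =>
    (cgIter_orthogonality y x₀ hA k hr).1 j (by omega)

/-- Breakdown is impossible before convergence: `r_j · p_j = r_j · r_j` keeps `p_j` nonzero, and
positive definiteness does the rest. -/
theorem cgSolvesInExactly_iff (hA : A.PosDef) (k : ℕ) :
    CGSolvesInExactly A y x₀ k ↔
      (cgIter A y x₀ k).r = 0 ∧ ∀ j < k, (cgIter A y x₀ j).r ≠ 0 := by
  have hx : ∀ j, A.mulVec (cgIter A y x₀ j).x = y ↔ (cgIter A y x₀ j).r = 0 := fun j => by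
    rw [cgIter_residual_eq, sub_eq_zero, eq_comm]
  constructor
  · rintro ⟨h0, h⟩
    exact ⟨(hx k).1 h0, fun j hj => mt (hx j).2 (h j hj).1⟩
  · rintro ⟨h0, h⟩
    refine ⟨(hx k).2 h0, fun j hj => ⟨mt (hx j).1 (h j hj), ?_,
      mt dotProduct_self_eq_zero.1 (h j hj)⟩⟩
    refine (dotProduct_mulVec_pos_of_ne_zero hA fun hp => h j hj ?_).ne'
    have h1 := (cgIter_orthogonality y x₀ hA j fun i hi => h i (by omega)).2.2
    rw [hp, dotProduct_zero] at h1
    exact dotProduct_self_eq_zero.1 h1.symm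

variable (A) [DecidableEq ι]

/-- The residual is a polynomial in the matrix, normalized to be `1` at `0`, applied to the
initial residual. -/
theorem cgIter_exists_polynomial (k : ℕ) :
    ∃ q s : ℝ[X], q.natDegree ≤ k ∧ s.natDegree ≤ k ∧ q.eval 0 = 1 ∧
      (cgIter A y x₀ k).r = aeval (Matrix.toLin' A) q (y - A.mulVec x₀) ∧
      (cgIter A y x₀ k).p = aeval (Matrix.toLin' A) s (y - A.mulVec x₀) := by
  induction k with
  | zero => exact ⟨1, 1, by simp, by simp, by simp, by simp [cgIter, cgInit],
      by simp [cgIter, cgInit]⟩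
  | succ k ih =>
    obtain ⟨q, s, hq, hs, h0, hr, hp⟩ := ih
    set a := (cgIter A y x₀ k).r ⬝ᵥ (cgIter A y x₀ k).r /
        ((cgIter A y x₀ k).p ⬝ᵥ A.mulVec (cgIter A y x₀ k).p) with ha
    set b := (cgIter A y x₀ (k + 1)).r ⬝ᵥ (cgIter A y x₀ (k + 1)).r /
        ((cgIter A y x₀ k).r ⬝ᵥ (cgIter A y x₀ k).r) with hb
    have hq' : (q - C a * (X * s)).natDegree ≤ k + 1 := by
      refine (natDegree_sub_le _ _).trans (max_le (by omega) ?_)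
      refine (natDegree_C_mul_le _ _).trans (natDegree_mul_le.trans ?_)
      rw [natDegree_X]; omega
    have hr' : (cgIter A y x₀ (k + 1)).r =
        aeval (Matrix.toLin' A) (q - C a * (X * s)) (y - A.mulVec x₀) := by
      rw [cgIter_residual_succ, ← ha, hr, hp]
      simp [aeval_C, Module.algebraMap_end_apply]
    refine ⟨q - C a * (X * s), q - C a * (X * s) + C b * s, hq', ?_, ?_, hr', ?_⟩
    · refine (natDegree_add_le _ _).trans (max_le hq' ?_)
      exact (natDegree_C_mul_le _ _).trans (by omega)
    · simp [h0]
    · rw [cgIter_direction_succ, ← hb, hr', hp]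
      simp [aeval_C, Module.algebraMap_end_apply]

variable {A}

/-- If a nonzero polynomial in the matrix annihilates the initial residual, the method
terminates within as many steps as its degree. -/
theorem exists_cgIter_residual_eq_zero (hA : A.PosDef) {P : ℝ[X]} (hP : P ≠ 0)
    (hPr : aeval (Matrix.toLin' A) P (y - A.mulVec x₀) = 0) :
    ∃ k ≤ P.natDegree, (cgIter A y x₀ k).r = 0 := by
  by_contra! hne
  -- Reduction modulo `P` puts every residual in the range of `g`, of dimension at most `deg P`,
  -- which has no room for `deg P + 1` nonzero orthogonal vectors.
  let g : (Fin P.natDegree → ℝ) →ₗ[ℝ] (ι → ℝ) :=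
    (LinearMap.applyₗ (y - A.mulVec x₀)) ∘ₗ (aeval (Matrix.toLin' A)).toLinearMap ∘ₗ
      (degreeLT ℝ P.natDegree).subtype ∘ₗ (degreeLTEquiv ℝ P.natDegree).symm.toLinearMap
  have hmem : ∀ k, (cgIter A y x₀ k).r ∈ LinearMap.range g := by
    intro k
    obtain ⟨q, _, _, _, _, hq, _⟩ := cgIter_exists_polynomial A y x₀ k
    have hlt : q % P ∈ degreeLT ℝ P.natDegree := by
      rw [mem_degreeLT, ← degree_eq_natDegree hP]
      exact degree_mod_lt q hP
    refine ⟨degreeLTEquiv ℝ P.natDegree ⟨q % P, hlt⟩, ?_⟩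
    have hmod : aeval (Matrix.toLin' A) q (y - A.mulVec x₀) =
        aeval (Matrix.toLin' A) (q % P) (y - A.mulVec x₀) := by
      conv_lhs => rw [← EuclideanDomain.div_add_mod q P, mul_comm P]
      rw [map_add, map_mul, LinearMap.add_apply, Module.End.mul_apply, hPr, map_zero, zero_add]
    rw [hq, hmod]
    simp [g]
  have hortho : ∀ i j : Fin (P.natDegree + 1), i ≠ j →
      (cgIter A y x₀ i).r ⬝ᵥ (cgIter A y x₀ j).r = 0 := by
    intro i j hij
    rcases lt_or_gt_of_ne (Fin.val_ne_of_ne hij) with h | h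
    · rw [dotProduct_comm]
      exact cgIter_residual_orthogonal y x₀ hA h fun l hl => hne l (by omega)
    · exact cgIter_residual_orthogonal y x₀ hA h fun l hl => hne l (by omega)
  have hli : LinearIndependent ℝ
      (fun i : Fin (P.natDegree + 1) => (⟨_, hmem i⟩ : LinearMap.range g)) := by
    rw [Fintype.linearIndependent_iff]
    intro c hc i
    have h1 := congrArg (fun v : LinearMap.range g => (v : ι → ℝ) ⬝ᵥ (cgIter A y x₀ i).r) hc
    simp only [Submodule.coe_sum, Submodule.coe_smul, sum_dotProduct, smul_dotProduct,
      smul_eq_mul, ZeroMemClass.coe_zero, zero_dotProduct] at h1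
    rw [Finset.sum_eq_single i (fun j _ hj => by rw [hortho j i hj, mul_zero]) (by simp)] at h1
    exact (mul_eq_zero.1 h1).resolve_right
      (mt dotProduct_self_eq_zero.1 (hne i (by omega)))
  have h1 := hli.fintype_card_le_finrank
  have h2 := LinearMap.finrank_range_le g
  simp at h1 h2
  omega

/-- Symmetry moves each power of `A` onto the eigenvector. -/
theorem dotProduct_aeval_of_mem_eigenspace (hA : A.IsSymm) {μ : ℝ} {v : ι → ℝ}
    (hv : v ∈ Module.End.eigenspace (Matrix.toLin' A) μ) (q : ℝ[X]) (r : ι → ℝ) :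
    v ⬝ᵥ aeval (Matrix.toLin' A) q r = q.eval μ * (v ⬝ᵥ r) := by
  rw [Module.End.mem_eigenspace_iff, Matrix.toLin'_apply] at hv
  induction q using Polynomial.induction_on' with
  | add p q hp hq => simp [hp, hq, dotProduct_add, add_mul]
  | monomial m a =>
    have : ∀ m : ℕ, v ⬝ᵥ (Matrix.toLin' A ^ m) r = μ ^ m * (v ⬝ᵥ r) := by
      intro m
      induction m with
      | zero => simp
      | succ m ih =>
        rw [pow_succ', Module.End.mul_apply, Matrix.toLin'_apply,
          dotProduct_mulVec_comm_of_isSymm hA, hv, smul_dotProduct, ih, smul_eq_mul, pow_succ']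
        ring
    simp [aeval_monomial, Module.algebraMap_end_apply, dotProduct_smul, this, mul_assoc]

/-- If `∏ (A - μ)` over a finite set `s` of eigenvalue candidates vanishes and `r` is orthogonal to
the eigenspace of `μ ∈ s`, then the factor of `μ` may be dropped to annihilate `r`. -/
theorem aeval_prod_erase_eq_zero (hA : A.IsSymm) {s : Finset ℝ}
    (hs : aeval (Matrix.toLin' A) (∏ μ ∈ s, (X - C μ)) = 0) {μ : ℝ} (hμ : μ ∈ s) {r : ι → ℝ}
    (hr : ∀ v ∈ Module.End.eigenspace (Matrix.toLin' A) μ, v ⬝ᵥ r = 0) :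
    aeval (Matrix.toLin' A) (∏ ν ∈ s.erase μ, (X - C ν)) r = 0 := by
  set Q : ℝ[X] := ∏ ν ∈ s.erase μ, (X - C ν)
  have hw : aeval (Matrix.toLin' A) Q r ∈ Module.End.eigenspace (Matrix.toLin' A) μ := by
    rw [← Finset.mul_prod_erase s _ hμ, map_mul] at hs
    have h1 := LinearMap.congr_fun hs r
    rw [Module.End.mem_eigenspace_iff, ← sub_eq_zero]
    simpa [Module.algebraMap_end_apply, Q] using h1
  -- With `w = Q(A) r` itself in the eigenspace, `w · w = Q(μ) (w · r) = 0`.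
  rw [← dotProduct_self_eq_zero, dotProduct_aeval_of_mem_eigenspace hA hw, hr _ hw, mul_zero]

/-- The method applied to a positive definite matrix takes at most as many iterations as there
are eigenvalues. -/
theorem exists_cgSolvesInExactly (hA : A.PosDef) {s : Finset ℝ}
    (hs : aeval (Matrix.toLin' A) (∏ μ ∈ s, (X - C μ)) (y - A.mulVec x₀) = 0) :
    ∃ k ≤ s.card, CGSolvesInExactly A y x₀ k := by
  classical
  obtain ⟨k, hk, h0⟩ := exists_cgIter_residual_eq_zero y x₀ hA
    (Finset.prod_ne_zero_iff.2 fun μ _ => X_sub_C_ne_zero μ) hs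
  rw [natDegree_finsetProd_X_sub_C_eq_card] at hk
  have hex : ∃ k, (cgIter A y x₀ k).r = 0 := ⟨k, h0⟩
  exact ⟨Nat.find hex, (Nat.find_min' hex h0).trans hk, (cgSolvesInExactly_iff y x₀ hA _).2
    ⟨Nat.find_spec hex, fun j hj => Nat.find_min hex hj⟩⟩

/-- If the eigenspace of `μ` is missed, its factor can be dropped and the method stops earlier.
Otherwise the residual polynomial at termination vanishes on all of `s`, and being `1` at `0` it is
nonzero, so its degree is at least `s.card`. -/
theorem cgSolvesInExactly_card_iff (hA : A.PosDef) {s : Finset ℝ}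
    (hs : aeval (Matrix.toLin' A) (∏ μ ∈ s, (X - C μ)) = 0) :
    CGSolvesInExactly A y x₀ s.card ↔ ∀ μ ∈ s,
      ∃ v ∈ Module.End.eigenspace (Matrix.toLin' A) μ, v ⬝ᵥ (y - A.mulVec x₀) ≠ 0 := by
  have hS : A.IsSymm := by simpa [Matrix.IsHermitian, Matrix.IsSymm] using hA.isHermitian
  constructor
  · intro h μ hμ
    by_contra! hr
    obtain ⟨k, hk, hsol⟩ := exists_cgSolvesInExactly y x₀ hA (aeval_prod_erase_eq_zero hS hs hμ hr)
    rw [Finset.card_erase_of_mem hμ] at hk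
    have := Finset.card_pos.2 ⟨μ, hμ⟩
    exact (h.2 k (by omega)).1 hsol.1
  · intro h
    obtain ⟨k, hk, hsol⟩ := exists_cgSolvesInExactly y x₀ hA (s := s) (by rw [hs]; rfl)
    obtain ⟨q, _, hq, _, h1, hr, _⟩ := cgIter_exists_polynomial A y x₀ k
    rw [((cgSolvesInExactly_iff y x₀ hA k).1 hsol).1] at hr
    have hroots : ∀ μ ∈ s, q.eval μ = 0 := by
      intro μ hμ
      obtain ⟨v, hv, hne⟩ := h μ hμ
      have h2 := dotProduct_aeval_of_mem_eigenspace hS hv q (y - A.mulVec x₀)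
      rw [← hr, dotProduct_zero] at h2
      exact (mul_eq_zero.1 h2.symm).resolve_right hne
    have hcard : s.card ≤ k := by
      by_contra! hlt
      have h3 := eq_zero_of_natDegree_lt_card_of_eval_eq_zero' q s hroots (by omega)
      simp [h3] at h1
    rwa [le_antisymm hcard hk]

/-- For each of the finitely many `μ`, fix one eigenvector `v`: the bad `y` lie in a translate of
the hyperplane orthogonal to `v`, a null set. -/
theorem ae_cgSolvesInExactly (hA : A.PosDef) {s : Finset ℝ}
    (hs : aeval (Matrix.toLin' A) (∏ μ ∈ s, (X - C μ)) = 0)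
    (hev : ∀ μ ∈ s, Module.End.HasEigenvalue (Matrix.toLin' A) μ) :
    ∀ᵐ y : ι → ℝ, CGSolvesInExactly A y x₀ s.card := by
  simp_rw [cgSolvesInExactly_card_iff _ x₀ hA hs]
  rw [Filter.eventually_all_finset]
  intro μ hμ
  obtain ⟨v, hv, hv0⟩ := (hev μ hμ).exists_hasEigenvector
  let K : Submodule ℝ (ι → ℝ) := LinearMap.ker (dotProductBilin ℝ ℝ v)
  have hK : ∀ z, z ∈ K ↔ v ⬝ᵥ z = 0 := fun z => LinearMap.mem_ker
  have hKtop : K ≠ ⊤ := fun h => hv0 <| dotProduct_self_eq_zero.1 <|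
    (hK v).1 (h ▸ Submodule.mem_top)
  have hnull : volume ((· - A.mulVec x₀) ⁻¹' (K : Set (ι → ℝ))) = 0 :=
    (measurePreserving_sub_right volume (A.mulVec x₀)).quasiMeasurePreserving.preimage_null
      (Measure.addHaar_submodule _ K hKtop)
  filter_upwards [measure_eq_zero_iff_ae_notMem.1 hnull] with y hy
  exact ⟨v, hv, fun h => hy ((hK _).2 h)⟩

end ConjugateGradientTheory

/-! ### Dirichlet's integral over the simplex. -/

section Dirichlet

/-- Integration by parts trades a factor `s - t` for a factor `t`; the boundary terms vanish. -/
theorem intervalIntegral_pow_mul_sub_pow (s : ℝ) (a b : ℕ) :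
    ∫ t in (0 : ℝ)..s, t ^ a * (s - t) ^ b =
      (a.factorial * b.factorial : ℝ) / (a + b + 1).factorial * s ^ (a + b + 1) := by
  induction b generalizing a with
  | zero =>
    simp only [pow_zero, mul_one, integral_pow, Nat.factorial_zero, Nat.cast_one, add_zero,
      Nat.factorial_succ, Nat.cast_mul]
    have := Nat.factorial_ne_zero a
    field_simp
    simp
  | succ b ih =>
    have hd : ∀ t ∈ Set.uIcc 0 s, HasDerivAt (fun t : ℝ => t ^ (a + 1) * (s - t) ^ (b + 1))
        ((a + 1) * (t ^ a * (s - t) ^ (b + 1)) - (b + 1) * (t ^ (a + 1) * (s - t) ^ b)) t := by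
      intro t _
      have h1 := hasDerivAt_pow (a + 1) t
      have h2 := ((hasDerivAt_id t).const_sub s).pow (b + 1)
      refine (h1.mul h2).congr_deriv ?_
      simp
      ring
    have hi := intervalIntegral.integral_eq_sub_of_hasDerivAt hd
      (Continuous.intervalIntegrable (by fun_prop) _ _)
    rw [intervalIntegral.integral_sub (Continuous.intervalIntegrable (by fun_prop) _ _)
      (Continuous.intervalIntegrable (by fun_prop) _ _), intervalIntegral.integral_const_mul,
      intervalIntegral.integral_const_mul, ih] at hi
    have hb : a + 1 + b + 1 = a + (b + 1) + 1 := by ring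
    rw [hb] at hi
    have h3 := Nat.factorial_ne_zero (a + (b + 1) + 1)
    have h4 : (a + 1 : ℝ) ≠ 0 := by positivity
    have h5 : (a + 1 : ℝ) * ∫ t in (0 : ℝ)..s, t ^ a * (s - t) ^ (b + 1) =
        (a + 1) * (((a.factorial * (b + 1).factorial : ℝ)) / (a + (b + 1) + 1).factorial *
          s ^ (a + (b + 1) + 1)) := by
      rw [sub_eq_iff_eq_add] at hi
      rw [hi]
      simp only [Nat.factorial_succ a, Nat.factorial_succ b]
      push_cast
      simp
      ring
    exact mul_left_cancel₀ h4 h5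

/-- The right simplex in `ℝ^d` of size `s`. -/
def scaledSimplex (d : ℕ) (s : ℝ) : Set (Fin d → ℝ) :=
  {x | (∀ i, 0 ≤ x i) ∧ ∑ i, x i ≤ s}

theorem isCompact_scaledSimplex (d : ℕ) (s : ℝ) : IsCompact (scaledSimplex d s) := by
  refine (isCompact_Icc (a := (0 : Fin d → ℝ)) (b := fun _ => s)).of_isClosed_subset ?_ ?_
  · have : scaledSimplex d s = (⋂ i, {x | 0 ≤ x i}) ∩ {x | ∑ i, x i ≤ s} := by
      ext; simp [scaledSimplex]
    rw [this]
    exact (isClosed_iInter fun i => isClosed_le continuous_const (continuous_apply i)).inter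
      (isClosed_le (by fun_prop) continuous_const)
  · rintro x ⟨h0, h1⟩
    exact ⟨h0, fun i => (Finset.single_le_sum (fun j _ => h0 j) (Finset.mem_univ i)).trans h1⟩

theorem cons_mem_scaledSimplex {d : ℕ} {s t : ℝ} {x : Fin d → ℝ} :
    (Fin.cons t x : Fin (d + 1) → ℝ) ∈ scaledSimplex (d + 1) s ↔
      0 ≤ t ∧ x ∈ scaledSimplex d (s - t) := by
  simp [scaledSimplex, Fin.forall_fin_succ, Fin.sum_univ_succ, le_sub_iff_add_le', and_assoc]

theorem le_of_mem_scaledSimplex_sub {d : ℕ} {s t : ℝ} {x : Fin d → ℝ}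
    (h : x ∈ scaledSimplex d (s - t)) : t ≤ s := by
  have := (Finset.sum_nonneg fun i _ => h.1 i).trans h.2
  linarith

/-- Dirichlet's integral of a monomial in the barycentric coordinates of a right simplex. -/
theorem setIntegral_scaledSimplex_monomial (d a : ℕ) (g : Fin d → ℕ) {s : ℝ} (hs : 0 ≤ s) :
    ∫ x in scaledSimplex d s, (s - ∑ i, x i) ^ a * ∏ i, x i ^ g i =
      (a.factorial * ∏ i, ((g i).factorial : ℝ)) / (a + ∑ i, g i + d).factorial *
        s ^ (a + ∑ i, g i + d) := by
  induction d generalizing s with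
  | zero =>
    have : scaledSimplex 0 s = Set.univ := by ext; simp [scaledSimplex, hs]
    have h3 := Nat.factorial_ne_zero a
    rw [this, volume_pi, Measure.pi_of_empty _ 0]
    simp [h3]
  | succ d ih =>
    let f : (Fin (d + 1) → ℝ) → ℝ := (scaledSimplex (d + 1) s).indicator
      fun x => (s - ∑ i, x i) ^ a * ∏ i, x i ^ g i
    have hm := (isCompact_scaledSimplex (d + 1) s).measurableSet
    have hf : Integrable f := by
      refine IntegrableOn.integrable_indicator ?_ hm
      exact ContinuousOn.integrableOn_compact (isCompact_scaledSimplex (d + 1) s)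
        (Continuous.continuousOn (by fun_prop))
    have hmp := (volume_preserving_piFinSuccAbove (fun _ : Fin (d + 1) => ℝ) 0).symm
    have hcons : ∀ p : ℝ × (Fin d → ℝ),
        (MeasurableEquiv.piFinSuccAbove (fun _ : Fin (d + 1) => ℝ) 0).symm p =
          Fin.cons p.1 p.2 := fun p => by
      simp [MeasurableEquiv.piFinSuccAbove, Fin.insertNthEquiv]
    -- The slice at first coordinate `t` is a simplex of size `s - t`, which is why the induction
    -- leaves the size free. Outside `[0, s]` the integrand vanishes on the slice.
    have hfc : ∀ t : ℝ, ∫ x : Fin d → ℝ, f (Fin.cons t x) = (Set.Icc 0 s).indicator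
        (fun t => (a.factorial * ∏ i : Fin d, ((g i.succ).factorial : ℝ)) /
          (a + ∑ i : Fin d, g i.succ + d).factorial *
            (t ^ g 0 * (s - t) ^ (a + ∑ i : Fin d, g i.succ + d))) t := by
      intro t
      by_cases ht : t ∈ Set.Icc 0 s
      · rw [Set.indicator_of_mem ht]
        have h1 : ∀ x : Fin d → ℝ, f (Fin.cons t x) = (scaledSimplex d (s - t)).indicator
            (fun x => t ^ g 0 * ((s - t - ∑ i, x i) ^ a * ∏ i, x i ^ g i.succ)) x := by
          intro x
          by_cases hx : x ∈ scaledSimplex d (s - t)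
          · rw [Set.indicator_of_mem hx]
            simp only [f]
            rw [Set.indicator_of_mem (cons_mem_scaledSimplex.2 ⟨ht.1, hx⟩)]
            simp only [Fin.sum_univ_succ, Fin.prod_univ_succ, Fin.cons_zero, Fin.cons_succ]
            rw [sub_sub]
            ring
          · rw [Set.indicator_of_notMem hx]
            exact Set.indicator_of_notMem (fun h => hx (cons_mem_scaledSimplex.1 h).2) _
        simp_rw [h1]
        rw [integral_indicator (isCompact_scaledSimplex d _).measurableSet, integral_const_mul,
          ih _ (sub_nonneg.2 ht.2)]
        ring
      · rw [Set.indicator_of_notMem ht]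
        refine integral_eq_zero_of_ae (Filter.Eventually.of_forall fun x => ?_)
        refine Set.indicator_of_notMem (fun h => ht ?_) _
        obtain ⟨h0, hx⟩ := cons_mem_scaledSimplex.1 h
        exact ⟨h0, le_of_mem_scaledSimplex_sub hx⟩
    rw [← integral_indicator hm]
    change ∫ x, f x = _
    have hfi := (hmp.integrable_comp_emb (MeasurableEquiv.measurableEmbedding _)).2 hf
    rw [← hmp.integral_comp']
    simp_rw [Function.comp_def, hcons] at hfi ⊢
    rw [Measure.volume_eq_prod, integral_prod _ hfi]
    simp_rw [hfc]
    rw [integral_indicator measurableSet_Icc, integral_Icc_eq_integral_Ioc,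
      ← intervalIntegral.integral_of_le hs, intervalIntegral.integral_const_mul,
      intervalIntegral_pow_mul_sub_pow, Fin.sum_univ_succ, Fin.prod_univ_succ]
    have hN : g 0 + (a + ∑ i : Fin d, g i.succ + d) + 1 =
      a + (g 0 + ∑ i : Fin d, g i.succ) + (d + 1) := by ring
    rw [hN]
    have h3 := Nat.factorial_ne_zero (a + ∑ i : Fin d, g i.succ + d)
    have h4 := Nat.factorial_ne_zero (a + (g 0 + ∑ i : Fin d, g i.succ) + (d + 1))
    field_simp

theorem setIntegral_unitSimplex_baryCoord (d : ℕ) (g : Fin (d + 1) → ℕ) :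
    ∫ x in unitSimplex d, ∏ i, baryCoord d x i ^ g i =
      (∏ i, ((g i).factorial : ℝ)) / (∑ i, g i + d).factorial := by
  have h := setIntegral_scaledSimplex_monomial d (g 0) (fun i => g i.succ) zero_le_one
  rw [one_pow, mul_one] at h
  simp only [Fin.prod_univ_succ, Fin.sum_univ_succ, baryCoord, Fin.cons_zero, Fin.cons_succ]
  exact h

end Dirichlet

/-! ### Spectrum of the Bernstein mass matrix. -/

section MassMatrix

variable {d n : ℕ}

theorem MultiIndex.sum_eq (α : MultiIndex d n) : ∑ i, α.1 i = n :=
  (Finset.mem_piAntidiag.1 α.2).1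

/-- The vector `α ↦ ∏ᵢ (αᵢ choose γᵢ)`. -/
def chooseVec (n : ℕ) (γ : Fin (d + 1) → ℕ) (α : MultiIndex d n) : ℝ :=
  ∏ i, ((α.1 i).choose (γ i) : ℝ)

/-- The `k`-th eigenvalue `(n!)² / ((n + k + d)! (n - k)!)` of the Bernstein mass matrix. -/
def massEigenvalue (d n k : ℕ) : ℝ :=
  (n.factorial : ℝ) ^ 2 / ((n + k + d).factorial * (n - k).factorial)

theorem massEigenvalue_pos (d n k : ℕ) : 0 < massEigenvalue d n k := by
  unfold massEigenvalue
  positivity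

/-- The ratio of consecutive values is `(n - k) / (n + k + d + 1)`. -/
theorem massEigenvalue_succ_lt {k : ℕ} (hk : k < n) :
    massEigenvalue d n (k + 1) < massEigenvalue d n k := by
  unfold massEigenvalue
  refine div_lt_div_of_pos_left (by positivity) (by positivity) ?_
  obtain ⟨m, rfl⟩ := Nat.exists_eq_add_of_lt hk
  have h1 : k + m + 1 - k = m + 1 := by omega
  have h2 : k + m + 1 - (k + 1) = m := by omega
  have h3 : k + m + 1 + (k + 1) + d = (k + m + 1 + k + d) + 1 := by ring
  rw [h1, h2, h3, Nat.factorial_succ, Nat.factorial_succ]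
  norm_cast
  have := Nat.mul_pos (k + m + 1 + k + d).factorial_pos m.factorial_pos
  nlinarith

theorem massEigenvalue_lt {j k : ℕ} (hjk : j < k) (hk : k ≤ n) :
    massEigenvalue d n k < massEigenvalue d n j := by
  induction k, hjk using Nat.le_induction with
  | base => exact massEigenvalue_succ_lt (by omega)
  | succ k hjk ih => exact (massEigenvalue_succ_lt (by omega)).trans (ih (by omega))

theorem massEigenvalue_injOn :
    Set.InjOn (massEigenvalue d n) (Finset.range (n + 1) : Set ℕ) := by
  intro j hj k hk h
  simp only [Finset.coe_range, Set.mem_Iio] at hj hk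
  rcases lt_trichotomy j k with hlt | heq | hlt
  · exact absurd h (massEigenvalue_lt hlt (by omega)).ne'
  · exact heq
  · exact absurd h (massEigenvalue_lt hlt (by omega)).ne

theorem sum_baryCoord (x : Fin d → ℝ) : ∑ i, baryCoord d x i = 1 := by
  simp [baryCoord, Fin.sum_univ_succ]

theorem continuous_baryCoord (i : Fin (d + 1)) : Continuous fun x => baryCoord d x i := by
  cases i using Fin.cases with
  | zero => simpa [baryCoord] using by fun_prop
  | succ i => simpa [baryCoord] using by fun_prop

theorem continuous_bernsteinSimplex (α : MultiIndex d n) :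
    Continuous (bernsteinSimplex d n α) := by
  have := @continuous_baryCoord d
  unfold bernsteinSimplex
  fun_prop

theorem isCompact_unitSimplex (d : ℕ) : IsCompact (unitSimplex d) :=
  isCompact_scaledSimplex d 1

/-- The Bernstein coefficients of a monomial in the barycentric coordinates. -/
theorem sum_chooseVec_mul_bernsteinSimplex (γ : Fin (d + 1) → ℕ) (hγ : ∑ i, γ i ≤ n)
    (x : Fin d → ℝ) :
    ∑ β : MultiIndex d n, chooseVec n γ β * bernsteinSimplex d n β x =
      (n.factorial : ℝ) / ((∏ i, ((γ i).factorial : ℝ)) * (n - ∑ i, γ i).factorial) *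
        ∏ i, baryCoord d x i ^ γ i := by
  -- Degree elevation: multiplying `b^γ` by `(∑ b_i)^(n - |γ|) = 1` makes it homogeneous of degree
  -- `n`.
  have h1 : (1 : ℝ) = ∑ δ ∈ Finset.univ.piAntidiag (n - ∑ i, γ i),
      (Nat.multinomial Finset.univ δ : ℝ) * ∏ i, baryCoord d x i ^ δ i := by
    rw [← Finset.sum_pow_eq_sum_piAntidiag, sum_baryCoord, one_pow]
  rw [← mul_one (_ * ∏ i, baryCoord d x i ^ γ i), h1, Finset.mul_sum]
  have h2 := Finset.sum_coe_sort (Finset.univ.piAntidiag n) fun β : Fin (d + 1) → ℕ =>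
    (∏ i, ((β i).choose (γ i) : ℝ)) * ((n.factorial : ℝ) / (∏ i, ((β i).factorial : ℝ)) *
      ∏ i, baryCoord d x i ^ β i)
  refine h2.trans (Eq.symm ?_)
  -- Terms match under `β = δ + γ`; any other `β` has some `β_i < γ_i` and a zero binomial.
  refine Finset.sum_of_injOn (fun δ => δ + γ) (fun _ _ _ _ h => add_right_cancel h) ?_ ?_ ?_
  · intro δ hδ
    simp only [Finset.mem_coe, Finset.mem_piAntidiag, Finset.mem_univ, implies_true,
      and_true] at hδ ⊢
    simp only [Pi.add_apply, Finset.sum_add_distrib, hδ]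
    omega
  · intro β hβ hnot
    have : ∃ i, β i < γ i := by
      by_contra! hle
      refine hnot ⟨β - γ, ?_, by ext i; simp [hle i]⟩
      simp only [Finset.mem_coe, Finset.mem_piAntidiag, Finset.mem_univ, implies_true,
        and_true] at hβ ⊢
      have h3 : ∑ i, (β - γ) i + ∑ i, γ i = ∑ i, β i := by
        rw [← Finset.sum_add_distrib]
        exact Finset.sum_congr rfl fun i _ => Nat.sub_add_cancel (hle i)
      have h4 : ∑ i, β i = n := hβ
      change ∑ i, (β - γ) i = _
      omega
    obtain ⟨i, hi⟩ := this
    rw [Finset.prod_eq_zero (Finset.mem_univ i) (by simp [Nat.choose_eq_zero_of_lt hi]), zero_mul]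
  · intro δ hδ
    have hm := Nat.multinomial_spec Finset.univ δ
    rw [(Finset.mem_piAntidiag.1 hδ).1] at hm
    have hm' : (∏ i, ((δ i).factorial : ℝ)) * (Nat.multinomial Finset.univ δ : ℝ) =
        (n - ∑ i, γ i).factorial := by exact_mod_cast hm
    have hc : ∏ i, (((δ + γ) i).factorial : ℝ) = (∏ i, (((δ + γ) i).choose (γ i) : ℝ)) *
        (∏ i, ((δ i).factorial : ℝ)) * ∏ i, ((γ i).factorial : ℝ) := by
      rw [← Finset.prod_mul_distrib, ← Finset.prod_mul_distrib]
      refine Finset.prod_congr rfl fun i _ => ?_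
      exact_mod_cast (Nat.add_choose_mul_factorial_mul_factorial (δ i) (γ i)).symm
    have hp : ∏ i, baryCoord d x i ^ (δ + γ) i =
        (∏ i, baryCoord d x i ^ δ i) * ∏ i, baryCoord d x i ^ γ i := by
      rw [← Finset.prod_mul_distrib]
      exact Finset.prod_congr rfl fun i _ => pow_add _ _ _
    have p1 : ∏ i, (((δ + γ) i).choose (γ i) : ℝ) ≠ 0 := Finset.prod_ne_zero_iff.2 fun i _ =>
      Nat.cast_ne_zero.2 (Nat.choose_pos (by simp)).ne'
    have p2 : ∏ i, ((δ i).factorial : ℝ) ≠ 0 := by positivity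
    have p3 : ∏ i, ((γ i).factorial : ℝ) ≠ 0 := by positivity
    have p4 : (Nat.multinomial Finset.univ δ : ℝ) ≠ 0 := by
      intro h0
      rw [h0, mul_zero] at hm'
      exact Nat.factorial_ne_zero _ (by exact_mod_cast hm'.symm)
    rw [hc, hp, ← hm']
    field_simp

theorem massMatrix_isSymm (d n : ℕ) : (massMatrix d n).IsSymm := by
  ext α β
  simp [massMatrix, mul_comm]

/-- Each entry is a multiple of the Dirichlet integral of `b^(α + γ)`, whose factorials regroup into
the binomials. -/
theorem massMatrix_mulVec_chooseVec (γ : Fin (d + 1) → ℕ) (hγ : ∑ i, γ i ≤ n)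
    (α : MultiIndex d n) :
    (massMatrix d n).mulVec (chooseVec n γ) α =
      massEigenvalue d n (∑ i, γ i) * ∏ i, ((α.1 i + γ i).choose (γ i) : ℝ) := by
  have hint : ∀ β : MultiIndex d n, IntegrableOn (fun x => bernsteinSimplex d n α x *
      bernsteinSimplex d n β x * chooseVec n γ β) (unitSimplex d) := fun β =>
    (((continuous_bernsteinSimplex α).mul (continuous_bernsteinSimplex β)).mul
      continuous_const).continuousOn.integrableOn_compact (isCompact_unitSimplex d)
  have h1 : (massMatrix d n).mulVec (chooseVec n γ) α = ∫ x in unitSimplex d,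
      ∑ β : MultiIndex d n, bernsteinSimplex d n α x * bernsteinSimplex d n β x *
        chooseVec n γ β := by
    rw [integral_finsetSum _ fun β _ => hint β]
    simp only [Matrix.mulVec, dotProduct, massMatrix, Matrix.of_apply, integral_mul_const]
  have h2 : ∀ x, ∑ β : MultiIndex d n, bernsteinSimplex d n α x * bernsteinSimplex d n β x *
      chooseVec n γ β = (n.factorial : ℝ) ^ 2 / ((∏ i, ((α.1 i).factorial : ℝ)) *
        (∏ i, ((γ i).factorial : ℝ)) * (n - ∑ i, γ i).factorial) *
        ∏ i, baryCoord d x i ^ (α.1 i + γ i) := by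
    intro x
    have : ∀ β : MultiIndex d n, bernsteinSimplex d n α x * bernsteinSimplex d n β x *
        chooseVec n γ β = bernsteinSimplex d n α x *
          (chooseVec n γ β * bernsteinSimplex d n β x) := fun β => by ring
    simp_rw [this]
    rw [← Finset.mul_sum, sum_chooseVec_mul_bernsteinSimplex γ hγ]
    simp_rw [pow_add]
    rw [Finset.prod_mul_distrib, bernsteinSimplex]
    field_simp
  rw [h1]
  simp_rw [h2]
  rw [integral_const_mul, setIntegral_unitSimplex_baryCoord d fun i => α.1 i + γ i,
    Finset.sum_add_distrib, α.sum_eq, massEigenvalue]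
  have hc : ∏ i, ((α.1 i + γ i).factorial : ℝ) = (∏ i, ((α.1 i + γ i).choose (γ i) : ℝ)) *
      (∏ i, ((α.1 i).factorial : ℝ)) * ∏ i, ((γ i).factorial : ℝ) := by
    rw [← Finset.prod_mul_distrib, ← Finset.prod_mul_distrib]
    refine Finset.prod_congr rfl fun i _ => ?_
    exact_mod_cast (Nat.add_choose_mul_factorial_mul_factorial (α.1 i) (γ i)).symm
  rw [hc]
  have p2 : ∏ i, ((α.1 i).factorial : ℝ) ≠ 0 := by positivity
  have p3 : ∏ i, ((γ i).factorial : ℝ) ≠ 0 := by positivity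
  field_simp

/-- Vandermonde's identity, used to re-expand shifted binomials in the vectors `chooseVec n δ`. -/
theorem add_choose_eq_sum_range (a m : ℕ) :
    ((a + m).choose m : ℝ) = ∑ j ∈ Finset.range (m + 1), (m.choose j : ℝ) * (a.choose j : ℝ) := by
  rw [Nat.add_choose_eq, Finset.Nat.sum_antidiagonal_eq_sum_range_succ
    (fun i j => a.choose i * m.choose j)]
  push_cast
  refine Finset.sum_congr rfl fun j hj => ?_
  rw [Nat.choose_symm (Finset.mem_range_succ_iff.1 hj), mul_comm]

/-- The vectors `chooseVec n γ` with `|γ| < k` span an invariant subspace of the mass matrix. -/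
def chooseSpan (d n k : ℕ) : Submodule ℝ (MultiIndex d n → ℝ) :=
  Submodule.span ℝ (chooseVec n '' {γ : Fin (d + 1) → ℕ | ∑ i, γ i < k})

/-- In the Vandermonde expansion the index `δ = γ` has coefficient `1`, and every other `δ ≤ γ` has
smaller total degree. -/
theorem massMatrix_sub_eigenvalue_mem_chooseSpan {k : ℕ} (hk : k ≤ n) {v : MultiIndex d n → ℝ}
    (hv : v ∈ chooseSpan d n (k + 1)) :
    Matrix.toLin' (massMatrix d n) v - massEigenvalue d n k • v ∈ chooseSpan d n k := by
  have hmain : ∀ γ : Fin (d + 1) → ℕ, ∑ i, γ i ≤ n →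
      Matrix.toLin' (massMatrix d n) (chooseVec n γ) -
        massEigenvalue d n (∑ i, γ i) • chooseVec n γ ∈ chooseSpan d n (∑ i, γ i) := by
    intro γ hγ
    have h1 : Matrix.toLin' (massMatrix d n) (chooseVec n γ) = massEigenvalue d n (∑ i, γ i) •
        ∑ δ ∈ Fintype.piFinset fun i => Finset.range (γ i + 1),
          (∏ i, ((γ i).choose (δ i) : ℝ)) • chooseVec n δ := by
      ext α
      rw [Matrix.toLin'_apply, massMatrix_mulVec_chooseVec γ hγ]
      simp_rw [add_choose_eq_sum_range]
      rw [Finset.prod_univ_sum]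
      simp [chooseVec, Finset.prod_mul_distrib]
    have hmem : γ ∈ Fintype.piFinset fun i => Finset.range (γ i + 1) := by simp
    rw [h1, ← smul_sub, ← Finset.add_sum_erase _ _ hmem]
    simp only [Nat.choose_self, Nat.cast_one, Finset.prod_const_one, one_smul,
      add_sub_cancel_left]
    refine Submodule.smul_mem _ _ (Submodule.sum_mem _ fun δ hδ => Submodule.smul_mem _ _
      (Submodule.subset_span ⟨δ, ?_, rfl⟩))
    obtain ⟨hne, hle⟩ := Finset.mem_erase.1 hδ
    simp only [Fintype.mem_piFinset, Finset.mem_range_succ_iff] at hle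
    obtain ⟨i, hi⟩ := Function.ne_iff.1 hne
    exact Finset.sum_lt_sum (fun i _ => hle i) ⟨i, Finset.mem_univ i, lt_of_le_of_ne (hle i) hi⟩
  induction hv using Submodule.span_induction with
  | mem v hv =>
    obtain ⟨γ, hγ, rfl⟩ := hv
    have hγ : ∑ i, γ i < k + 1 := hγ
    rcases Nat.lt_succ_iff_lt_or_eq.1 hγ with h | rfl
    -- In lower degree the eigenvalue is the wrong one, but correcting it only adds a multiple of
    -- `chooseVec n γ`, already in the smaller span.
    · have hin : chooseVec n γ ∈ chooseSpan d n k := Submodule.subset_span ⟨γ, h, rfl⟩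
      have hmono : chooseSpan d n (∑ i, γ i) ≤ chooseSpan d n k :=
        Submodule.span_mono (Set.image_mono fun δ hδ => lt_trans hδ h)
      have h3 := Submodule.add_mem _ (hmono (hmain γ (by omega))) (Submodule.smul_mem _
        (massEigenvalue d n (∑ i, γ i) - massEigenvalue d n k) hin)
      convert h3 using 1
      module
    · exact hmain γ (by omega)
  | zero => simp
  | add v w _ _ hv hw =>
    convert Submodule.add_mem _ hv hw using 1
    rw [map_add]
    module
  | smul a v _ hv =>
    convert Submodule.smul_mem _ a hv using 1
    rw [map_smul]
    module

/-- A nonzero entry at `β` needs `α ≤ β`, and equal totals then force `β = α`. So the filtration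
reaches the whole space. -/
theorem chooseVec_self (α : MultiIndex d n) : chooseVec n α.1 = Pi.single α 1 := by
  ext β
  rcases eq_or_ne β α with rfl | hne
  · simp [chooseVec]
  · rw [Pi.single_eq_of_ne hne]
    have : ∃ i, β.1 i < α.1 i := by
      by_contra! hle
      refine hne (Subtype.ext (funext fun i => le_antisymm ?_ (hle i)))
      by_contra! hlt
      have := Finset.sum_lt_sum (fun i _ => hle i) ⟨i, Finset.mem_univ i, hlt⟩
      rw [α.sum_eq, β.sum_eq] at this
      exact lt_irrefl _ this
    obtain ⟨i, hi⟩ := this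
    exact Finset.prod_eq_zero (Finset.mem_univ i) (by simp [Nat.choose_eq_zero_of_lt hi])

theorem chooseSpan_succ_self (d n : ℕ) : chooseSpan d n (n + 1) = ⊤ := by
  refine eq_top_iff.2 fun v _ => ?_
  rw [pi_eq_sum_univ' v]
  refine Submodule.sum_mem _ fun α _ => Submodule.smul_mem _ _ (Submodule.subset_span
    ⟨α.1, by simp [α.sum_eq], ?_⟩)
  rw [chooseVec_self]

open Polynomial in
-- Each factor lowers the filtration by one level, and level `0` is the zero space.
theorem aeval_massMatrix_prod_eq_zero (d n : ℕ) :
    aeval (Matrix.toLin' (massMatrix d n))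
      (∏ k ∈ Finset.range (n + 1), (X - C (massEigenvalue d n k))) = 0 := by
  have h : ∀ k ≤ n + 1, ∀ v ∈ chooseSpan d n k, aeval (Matrix.toLin' (massMatrix d n))
      (∏ k ∈ Finset.range k, (X - C (massEigenvalue d n k))) v = 0 := by
    intro k
    induction k with
    | zero =>
      intro _ v hv
      have : v = 0 := by simpa [chooseSpan] using hv
      simp [this]
    | succ k ih =>
      intro hk v hv
      have h1 := ih (by omega) _ (massMatrix_sub_eigenvalue_mem_chooseSpan (by omega) hv)
      rw [Finset.prod_range_succ, map_mul, Module.End.mul_apply]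
      convert h1 using 2
      simp [Module.algebraMap_end_apply]
  exact LinearMap.ext fun v => h (n + 1) le_rfl v (chooseSpan_succ_self d n ▸ Submodule.mem_top)

/-- The vector `α ↦ (α₀ choose k)`. -/
def chooseZeroVec (d n k : ℕ) (α : MultiIndex d n) : ℝ := ((α.1 0).choose k : ℝ)

theorem chooseZeroVec_eq (d n k : ℕ) : chooseZeroVec d n k = chooseVec n (Pi.single 0 k) := by
  ext α
  rw [chooseZeroVec, chooseVec, Finset.prod_eq_single 0] <;> simp +contextual

theorem toLin'_massMatrix_chooseZeroVec {k : ℕ} (hk : k ≤ n) :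
    Matrix.toLin' (massMatrix d n) (chooseZeroVec d n k) = massEigenvalue d n k •
      ∑ j ∈ Finset.range (k + 1), (k.choose j : ℝ) • chooseZeroVec d n j := by
  ext α
  have hs : ∑ i : Fin (d + 1), (Pi.single 0 k : Fin (d + 1) → ℕ) i = k := by simp
  rw [chooseZeroVec_eq, Matrix.toLin'_apply, massMatrix_mulVec_chooseVec _ (by rw [hs]; exact hk),
    hs, Finset.prod_eq_single 0 (by simp +contextual) (by simp),
    Pi.single_eq_same, add_choose_eq_sum_range]
  simp [chooseZeroVec]

theorem linearIndependent_chooseZeroVec (hd : 1 ≤ d) {k : ℕ} (hk : k ≤ n + 1) :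
    LinearIndependent ℝ fun j : Fin k => chooseZeroVec d n j := by
  rw [Fintype.linearIndependent_iff]
  intro c hc
  have h0 : ∀ m (hm : m < k), c ⟨m, hm⟩ = 0 := by
    intro m
    induction m using Nat.strong_induction_on with
    | _ m ih =>
    intro hm
    have hne : (0 : Fin (d + 1)) ≠ Fin.last d := by
      intro h
      have := congrArg Fin.val h
      simp at this
      omega
    -- Evaluation at `α₀ = m` kills the terms `j > m`, and induction kills `j < m`. The remaining `n
    -- - m` needs a second coordinate, whence `d ≥ 1`.
    let α : MultiIndex d n := ⟨Pi.single 0 m + Pi.single (Fin.last d) (n - m), by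
      simp [Finset.sum_add_distrib]
      omega⟩
    have hα : α.1 0 = m := by simp [α, Pi.single_eq_of_ne hne]
    have h1 := congrFun hc α
    simp only [Finset.sum_apply, Pi.smul_apply, smul_eq_mul, chooseZeroVec, hα,
      Pi.zero_apply] at h1
    rw [Finset.sum_eq_single ⟨m, hm⟩ ?_ (by simp)] at h1
    · simpa using h1
    · intro j _ hj
      rcases lt_or_gt_of_ne (fun h => hj (Fin.ext h) : (j : ℕ) ≠ m) with h | h
      · rw [ih j h j.2, zero_mul]
      · rw [Nat.choose_eq_zero_of_lt h, Nat.cast_zero, mul_zero]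
  exact fun i => h0 i i.2

/-- Subtracting the scalar maps `U (k + 1)` into `U k`, one dimension smaller, so the difference has
a kernel. -/
theorem hasEigenvalue_massEigenvalue (hd : 1 ≤ d) {k : ℕ} (hk : k ≤ n) :
    Module.End.HasEigenvalue (Matrix.toLin' (massMatrix d n)) (massEigenvalue d n k) := by
  let U : ℕ → Submodule ℝ (MultiIndex d n → ℝ) := fun m =>
    Submodule.span ℝ (Set.range fun j : Fin m => chooseZeroVec d n j)
  have hU : ∀ m ≤ n + 1, Module.finrank ℝ (U m) = m := fun m hm => by
    rw [finrank_span_eq_card (linearIndependent_chooseZeroVec hd hm), Fintype.card_fin]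
  have hmem : ∀ {j m : ℕ}, j < m → chooseZeroVec d n j ∈ U m := fun {j m} h =>
    Submodule.subset_span ⟨⟨j, h⟩, rfl⟩
  let g : Module.End ℝ (MultiIndex d n → ℝ) :=
    Matrix.toLin' (massMatrix d n) - massEigenvalue d n k • 1
  have hg : (U (k + 1)).map g ≤ U k := by
    rw [Submodule.map_span_le]
    rintro _ ⟨⟨j, hj⟩, rfl⟩
    simp only [g, LinearMap.sub_apply, LinearMap.smul_apply, Module.End.one_apply]
    rw [toLin'_massMatrix_chooseZeroVec (by omega)]
    rcases Nat.lt_succ_iff_lt_or_eq.1 hj with h | rfl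
    · refine Submodule.sub_mem _ (Submodule.smul_mem _ _ (Submodule.sum_mem _ fun i hi =>
        Submodule.smul_mem _ _ (hmem ?_))) (Submodule.smul_mem _ _ (hmem h))
      have := Finset.mem_range.1 hi
      omega
    · rw [Finset.sum_range_succ, ← smul_sub, Nat.choose_self, Nat.cast_one, one_smul,
        add_sub_cancel_right]
      exact Submodule.smul_mem _ _ (Submodule.sum_mem _ fun i hi =>
        Submodule.smul_mem _ _ (hmem (Finset.mem_range.1 hi)))
  by_contra hev
  have hinj : Function.Injective g := by
    rw [← LinearMap.ker_eq_bot]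
    rw [Module.End.hasEigenvalue_iff, not_not] at hev
    refine (Submodule.eq_bot_iff _).2 fun v hv => ?_
    have : v ∈ Module.End.eigenspace (Matrix.toLin' (massMatrix d n)) (massEigenvalue d n k) := by
      rw [Module.End.mem_eigenspace_iff, ← sub_eq_zero]
      simpa [g] using hv
    rw [hev] at this
    simpa using this
  have h1 := (Submodule.equivMapOfInjective g hinj (U (k + 1))).finrank_eq
  have h2 := Submodule.finrank_mono hg
  rw [hU _ (by omega)] at h1 h2
  omega

open Polynomial in
theorem hasEigenvalue_massMatrix_iff (hd : 1 ≤ d) (μ : ℝ) :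
    Module.End.HasEigenvalue (Matrix.toLin' (massMatrix d n)) μ ↔
      μ ∈ (Finset.range (n + 1)).image (massEigenvalue d n) := by
  constructor
  · intro h
    obtain ⟨v, hv⟩ := h.exists_hasEigenvector
    have h1 := Module.End.aeval_apply_of_hasEigenvector hv
      (p := ∏ k ∈ Finset.range (n + 1), (X - C (massEigenvalue d n k)))
    rw [aeval_massMatrix_prod_eq_zero, LinearMap.zero_apply, eq_comm, smul_eq_zero_iff_left hv.2,
      eval_prod, Finset.prod_eq_zero_iff] at h1
    obtain ⟨k, hk, h2⟩ := h1
    refine Finset.mem_image.2 ⟨k, hk, ?_⟩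
    simpa [sub_eq_zero, eq_comm] using h2
  · intro h
    obtain ⟨k, hk, rfl⟩ := Finset.mem_image.1 h
    exact hasEigenvalue_massEigenvalue hd (Finset.mem_range_succ_iff.1 hk)

/-- Positivity is read off from the explicit eigenvalues. -/
theorem massMatrix_posDef (hd : 1 ≤ d) : (massMatrix d n).PosDef := by
  have hH : (massMatrix d n).IsHermitian := by
    simpa [Matrix.IsHermitian, Matrix.IsSymm] using massMatrix_isSymm d n
  rw [hH.posDef_iff_eigenvalues_pos]
  intro i
  have hev : Module.End.HasEigenvalue (Matrix.toLin' (massMatrix d n)) (hH.eigenvalues i) := by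
    rw [Module.End.hasEigenvalue_iff_mem_spectrum, Matrix.spectrum_toLin']
    exact hH.eigenvalues_mem_spectrum_real i
  obtain ⟨k, _, hk⟩ := Finset.mem_image.1 ((hasEigenvalue_massMatrix_iff hd _).1 hev)
  exact hk ▸ massEigenvalue_pos d n k

end MassMatrix

end

theorem mainTheorem5 (d n : ℕ) (hd : 1 ≤ d) :
    {μ : ℝ | Module.End.HasEigenvalue (Matrix.toLin' (massMatrix d n)) μ}.ncard = n + 1 ∧
    (∀ y x₀ : MultiIndex d n → ℝ,
      ∃ k ≤ n + 1, CGSolvesInExactly (massMatrix d n) y x₀ k) ∧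
    (∀ y x₀ : MultiIndex d n → ℝ,
      CGSolvesInExactly (massMatrix d n) y x₀ (n + 1) ↔
        ∀ μ : ℝ, Module.End.HasEigenvalue (Matrix.toLin' (massMatrix d n)) μ →
          ∃ v ∈ Module.End.eigenspace (Matrix.toLin' (massMatrix d n)) μ,
            v ⬝ᵥ (y - (massMatrix d n).mulVec x₀) ≠ 0) ∧
    (∀ x₀ : MultiIndex d n → ℝ, ∀ᵐ y : MultiIndex d n → ℝ,
      CGSolvesInExactly (massMatrix d n) y x₀ (n + 1)) := by
  have hev := hasEigenvalue_massMatrix_iff (n := n) hd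
  have hA := massMatrix_posDef (n := n) hd
  have hp := aeval_massMatrix_prod_eq_zero d n
  -- Distinctness turns the product over indices into one over the set of eigenvalues.
  rw [← Finset.prod_image (f := fun μ => Polynomial.X - Polynomial.C μ)
    massEigenvalue_injOn] at hp
  have hcard : ((Finset.range (n + 1)).image (massEigenvalue d n)).card = n + 1 := by
    rw [Finset.card_image_of_injOn massEigenvalue_injOn, Finset.card_range]
  set s := (Finset.range (n + 1)).image (massEigenvalue d n)
  refine ⟨?_, fun y x₀ => ?_, fun y x₀ => ?_, fun x₀ => ?_⟩
  · simp_rw [hev]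
    exact (Set.ncard_coe_finset s).trans hcard
  · exact hcard ▸ exists_cgSolvesInExactly y x₀ hA (by rw [hp]; rfl)
  · simp_rw [hev]
    exact hcard ▸ cgSolvesInExactly_card_iff y x₀ hA hp
  · exact hcard ▸ ae_cgSolvesInExactly x₀ hA hp fun μ hμ => (hev μ).2 hμ
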